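/- For a finite bounded graded poset $P$ with rank function $\rho$, least element $\widehat 0$, largest element $\widehat 1$ and Möbius function $\mu$, set, for $x\le y$ in $P$, \[ \chi_{[x,y]}(t)=\sum_{x\le z\le y}\mu(x,z)\,t^{\rho(y)-\rho(z)},\qquad \overline\chi_{[x,y]}(t)=\begin{cases}-1&\text{if }x=y,\\ \dfrac{\chi_{[x,y]}(t)}{t-1}&\text{if }x<y,\end{cases} \] and define $\mathrm H_{[x,y]}(t)\in\mathbb Z[t]$ by $\mathrm H=(-\overline\chi)^{-1}$ in the incidence algebra, that is, $\mathrm H_{[x,x]}(t)=1$ and \[ \mathrm H_{[x,y]}(t)=\sum_{x<z\le y}\overline\chi_{[x,z]}(t)\,\mathrm H_{[z,y]}(t)\qquad (x<y). \] The Chow polynomial of $P$ is $\mathrm H_P(t)=\mathrm H_{[\widehat 0,\widehat 1]}(t)$, and the (left) augmented Chow polynomial of $P$ is $G_P(t)=\sum_{x\in P}t^{\rho(x)}\,\mathrm H_{[x,\widehat 1]}(t)$. Let $0\le k\le n$ be integers, and let $\mathsf U_{k,n}$ be the uniform geometric lattice of rank $k$ over $n$ elements, that is, the poset obtained from the Boolean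 algebra of all subsets of $\{1,\dots,n\}$, ordered by inclusion, by truncating it $n-k$ times, where a truncation removes all coatoms. Let $(\mathsf U_{k,n})^*$ be the poset $\mathsf U_{k,n}$ with the reversed order. Then all complex zeros of $\mathrm H_{(\mathsf U_{k,n})^*}(t)$ and of $G_{(\mathsf U_{k,n})^*}(t)$ are real. -/

import Mathlib

/-! ### Chow polynomials of bounded graded posets -/

namespace ChowPoset

open Polynomial

section Chow

variable {P : Type*} [PartialOrder P] [LocallyFiniteOrder P] [DecidableEq P]

/-- The rank `ρ(x)` of an element: the length of a longest chain ending at `x`.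
In a finite graded poset with a least element all maximal chains from the least element to `x`
have this same length, so this is the rank function. -/
noncomputable def rank (x : P) : ℕ := (Order.height x).toNat

/-- The characteristic function `χ_{[x,y]}(t) = ∑_{x ≤ z ≤ y} μ(x,z) t^{ρ(y)-ρ(z)}`. -/
noncomputable def charPoly (x y : P) : ℤ[X] :=
  ∑ z ∈ Finset.Icc x y, C (IncidenceAlgebra.mu ℤ x z) * X ^ (rank y - rank z)

/-- The reduced characteristic function: `-1` on trivial intervals, and
`χ_{[x,y]}(t) / (t - 1)` otherwise (the division is exact for `x < y`). -/
noncomputable def redCharPoly (x y : P) : ℤ[X] :=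
  if x = y then -1 else charPoly x y /ₘ (X - C 1)

/-- The Chow function `H_{[x,y]}(t)`, the inverse of minus the reduced characteristic function in
the incidence algebra: `H_{[x,x]} = 1` and
`H_{[x,y]} = ∑_{x < z ≤ y} (reduced χ)_{[x,z]} H_{[z,y]}` for `x < y`. -/
noncomputable def chow (x y : P) : ℤ[X] :=
  if x = y then 1
  else ∑ z ∈ (Finset.Ioc x y).attach, redCharPoly x z.1 * chow z.1 y
termination_by (Finset.Icc x y).card
decreasing_by
  have hz := Finset.mem_Ioc.1 z.2
  refine Finset.card_lt_card (Finset.ssubset_iff_of_subset ?_ |>.2 ⟨x, ?_, ?_⟩)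
  · exact Finset.Icc_subset_Icc_left hz.1.le
  · exact Finset.left_mem_Icc.2 (hz.1.le.trans hz.2)
  · exact fun h => hz.1.not_ge (Finset.mem_Icc.1 h).1

theorem chow_self (x : P) : chow x x = 1 := by
  rw [chow, if_pos rfl]

theorem chow_of_ne {x y : P} (h : x ≠ y) :
    chow x y = ∑ z ∈ Finset.Ioc x y, redCharPoly x z * chow z y := by
  rw [chow, if_neg h]
  exact Finset.sum_attach (Finset.Ioc x y) (fun z => redCharPoly x z * chow z y)

/-- The (left) augmented Chow function `G_{[x,y]}(t) = ∑_{x ≤ z ≤ y} t^{ρ(z)-ρ(x)} H_{[z,y]}(t)`. -/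
noncomputable def augChow (x y : P) : ℤ[X] :=
  ∑ z ∈ Finset.Icc x y, X ^ (rank z - rank x) * chow z y

end Chow

/-- The Chow polynomial `H_P(t)` of a bounded poset. -/
noncomputable def chowPoly (P : Type*) [PartialOrder P] [LocallyFiniteOrder P] [DecidableEq P]
    [BoundedOrder P] : ℤ[X] :=
  chow (⊥ : P) ⊤

/-- The (left) augmented Chow polynomial `G_P(t)` of a bounded poset. -/
noncomputable def augChowPoly (P : Type*) [PartialOrder P] [LocallyFiniteOrder P] [DecidableEq P]
    [BoundedOrder P] : ℤ[X] :=
  augChow (⊥ : P) ⊤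

/-- All complex zeros of the polynomial are real (in particular it is not the zero polynomial). -/
def OnlyRealZeros (p : ℤ[X]) : Prop :=
  ∀ z : ℂ, aeval z p = 0 → z.im = 0

/-! ### Truncation and uniform geometric lattices -/

open Classical in
/-- The truncation of a subposet `S` containing the largest element `⊤`: remove all coatoms of `S`,
that is, all maximal elements of `S \ {⊤}`. -/
noncomputable def truncation {α : Type*} [PartialOrder α] [OrderTop α] (S : Finset α) : Finset α :=
  S.filter fun x => ¬ Maximal (fun y => y ∈ S ∧ y ≠ ⊤) x

theorem mem_truncation {α : Type*} [PartialOrder α] [OrderTop α] {S : Finset α} {x : α} :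
    x ∈ truncation S ↔ x ∈ S ∧ ¬ Maximal (fun y => y ∈ S ∧ y ≠ ⊤) x := by
  classical
  simp [truncation]

/-- The elements of `U_{k,n}`: truncate the Boolean algebra `B_n` of all subsets of an `n`-element
set `n - k` times. -/
noncomputable def uniformFinset (k n : ℕ) : Finset (Finset (Fin n)) :=
  truncation^[n - k] Finset.univ

theorem mem_truncation_iterate (n j : ℕ) (A : Finset (Fin n)) :
    A ∈ truncation^[j] (Finset.univ : Finset (Finset (Fin n))) ↔
      A.card < n - j ∨ A = Finset.univ := by
  induction j generalizing A with
  | zero =>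
    simp only [Function.iterate_zero, id, Finset.mem_univ, true_iff, Nat.sub_zero]
    by_cases h : A = Finset.univ
    · exact Or.inr h
    · left
      have := (Finset.card_lt_iff_ne_univ A).2 h
      simpa using this
  | succ j ih =>
    rw [Function.iterate_succ_apply', mem_truncation, ih]
    by_cases hA : A = Finset.univ
    · subst hA
      simp [Maximal]
    · simp only [hA, or_false]
      constructor
      · rintro ⟨h1, h2⟩
        by_contra h3
        refine h2 ⟨⟨(ih A).2 (Or.inl h1), hA⟩, ?_⟩
        rintro B ⟨hB, hBt⟩ hAB
        have hB' : B.card < n - j := ((ih B).1 hB).resolve_right hBt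
        exact (Finset.eq_of_subset_of_card_le hAB (by omega)).ge
      · intro h
        refine ⟨by omega, fun hm => ?_⟩
        obtain ⟨a, ha⟩ : ∃ a, a ∉ A := by
          by_contra! hc
          exact hA (Finset.eq_univ_iff_forall.2 hc)
        have hcard := Finset.card_insert_of_notMem ha
        have hne : insert a A ≠ Finset.univ := fun he => by
          have := congrArg Finset.card he
          rw [hcard, Finset.card_univ, Fintype.card_fin] at this
          omega
        have := hm.2 (y := insert a A) ⟨(ih _).2 (Or.inl (by omega)), hne⟩
          (Finset.subset_insert a A)
        exact ha (this (Finset.mem_insert_self a A))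

/-- The uniform geometric lattice `U_{k,n}`, ordered by inclusion. -/
abbrev UniformLattice (k n : ℕ) : Type := {A : Finset (Fin n) // A ∈ uniformFinset k n}

theorem univ_mem_uniformFinset (k n : ℕ) : Finset.univ ∈ uniformFinset k n :=
  (mem_truncation_iterate n (n - k) _).2 (Or.inr rfl)

theorem exists_least_uniformFinset (k n : ℕ) : ∃ b : UniformLattice k n, ∀ x, b ≤ x := by
  by_cases h : (∅ : Finset (Fin n)) ∈ uniformFinset k n
  · exact ⟨⟨∅, h⟩, fun x => Finset.empty_subset x.1⟩
  · refine ⟨⟨Finset.univ, univ_mem_uniformFinset k n⟩, fun x => ?_⟩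
    have h0 : ¬ (0 < n - (n - k)) := fun h0 =>
      h ((mem_truncation_iterate n (n - k) _).2 (Or.inl (by simpa using h0)))
    have hx := ((mem_truncation_iterate n (n - k) x.1).1 x.2).resolve_left (by omega)
    exact hx.ge

noncomputable instance uniformBoundedOrder (k n : ℕ) : BoundedOrder (UniformLattice k n) where
  top := ⟨Finset.univ, univ_mem_uniformFinset k n⟩
  le_top x := Finset.subset_univ x.1
  bot := (exists_least_uniformFinset k n).choose
  bot_le := (exists_least_uniformFinset k n).choose_spec

end ChowPoset

/-! Write A_j for the Eulerian polynomials. Möbius inversion removes μ from the definitions: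
G_{[x,y]} = t ∑ H_{[w,y]} + (1 - t), the sum over w in [x,y]. Isolating w = x gives a recurrence for
(1 - t) H involving only ranks (`one_sub_X_mul_chow`). In the dual of U_{k,n}, the interval above a
proper subset of size j is Boolean, with Chow polynomial A_j. Hence (1 - z) H(z) = (1 - z) + ∑_{j<K}
C(n,j) (z - z^{K-j}) A_j(z) with K = k, and (1 - z) G(z) is the same expression with K = k + 1. It
remains to show that this expression (`chowValue`) does not vanish when Im z > 0; conjugation
handles the lower half-plane.

For K = m + 1 and n = m + e it equals ∑ c_i q_i - z ∑ c_i p_i with c_i = `e.multichoose i` ≥ 0,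
where p_i = ∑_l C(m-i,l) z^{m-i-l} A_{i+l}(z) and q_i = ∑_l C(m-i,l) z A_{i+l}(z), plus 1 - z if i =
0 (`chowValue_eq`). For m ≥ 1 the points p_m, ..., p_0 = q_0, ..., q_m = z p_m occur in
counterclockwise order around the origin (`isConvexPair_lowerValue_upperValue`). So each q_i weakly
precedes each z p_j, and strictly for i = j = 0; the two sums therefore differ.

The angular order is proved by induction on m: the steps of the new path are the old points, rotated
and scaled by z or negated, so the new path is convex. The induction also needs A_m(z), A_{m+1}(z),
z A_m(z) to be in strict angular order, which follows from the negative real zeros of A_m and the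
partial fractions of A_{m+1}/A_m. -/

namespace ChowPoset

open Polynomial

/-! ### Iterated binomial transforms -/

/-- The weighted iterated binomial transform of a sequence,
`∑ l, (r.choose l) * w ^ (r - l) * u (i + l)`. -/
def binomTransform {R : Type*} [CommRing R] (w : R) (u : ℕ → R) : ℕ → ℕ → R
  | 0, i => u i
  | r + 1, i => binomTransform w u r (i + 1) + w * binomTransform w u r i

theorem binomTransform_eq_sum {R : Type*} [CommRing R] (w : R) (u : ℕ → R) (r i : ℕ) :
    binomTransform w u r i =
      ∑ l ∈ Finset.range (r + 1), (r.choose l : R) * w ^ (r - l) * u (i + l) := by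
  induction r generalizing i with
  | zero => simp [binomTransform]
  | succ r ih =>
    rw [binomTransform, ih, ih, Finset.sum_range_succ' _ (r + 1), Finset.mul_sum,
      Finset.sum_range_succ' (fun l => w * ((r.choose l : R) * w ^ (r - l) * u (i + l))) r]
    have h : ∀ l ∈ Finset.range (r + 1),
        ((r + 1).choose (l + 1) : R) * w ^ (r + 1 - (l + 1)) * u (i + (l + 1)) =
          (r.choose l : R) * w ^ (r - l) * u (i + 1 + l) +
            (r.choose (l + 1) : R) * w ^ (r - l) * u (i + (l + 1)) := by
      intro l _
      rw [Nat.choose_succ_succ, Nat.add_sub_add_right, show i + 1 + l = i + (l + 1) by ring]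
      push_cast
      ring
    rw [Finset.sum_congr rfl h, Finset.sum_add_distrib,
      Finset.sum_range_succ (fun l => (r.choose (l + 1) : R) * w ^ (r - l) * u (i + (l + 1))) r]
    have h' : ∀ l ∈ Finset.range r,
        w * ((r.choose (l + 1) : R) * w ^ (r - (l + 1)) * u (i + (l + 1))) =
          (r.choose (l + 1) : R) * w ^ (r - l) * u (i + (l + 1)) := by
      intro l hl
      rw [show r - l = r - (l + 1) + 1 by have := Finset.mem_range.1 hl; omega]
      ring
    rw [Finset.sum_congr rfl h']
    simp only [Nat.choose_succ_self, Nat.choose_zero_right, Nat.sub_zero, pow_succ]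
    push_cast
    ring

theorem map_binomTransform {R S : Type*} [CommRing R] [CommRing S] (φ : R →+* S) (w : R)
    (u : ℕ → R) (r i : ℕ) :
    φ (binomTransform w u r i) = binomTransform (φ w) (fun j => φ (u j)) r i := by
  induction r generalizing i with
  | zero => rfl
  | succ r ih => simp [binomTransform, ih]

/-! ### Eulerian polynomials -/

/-- The differential operator of the recurrence of the Eulerian polynomials. -/
noncomputable def eulerianOp (n : ℕ) (p : ℂ[X]) : ℂ[X] :=
  (1 + (n : ℂ[X]) * X) * p + X * (1 - X) * derivative p

/-- The Eulerian polynomials `∑ σ ∈ S_m, X ^ des σ`. -/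
noncomputable def eulerian : ℕ → ℂ[X]
  | 0 => 1
  | m + 1 => eulerianOp m (eulerian m)

theorem eulerianOp_add (n : ℕ) (p q : ℂ[X]) :
    eulerianOp n (p + q) = eulerianOp n p + eulerianOp n q := by
  simp only [eulerianOp, derivative_add]; ring

theorem eulerianOp_succ (n : ℕ) (p : ℂ[X]) : eulerianOp (n + 1) p = eulerianOp n p + X * p := by
  simp only [eulerianOp]; push_cast; ring

theorem eulerianOp_X_mul (n : ℕ) (p : ℂ[X]) :
    eulerianOp n (X * p) = X * eulerianOp n p + X * (1 - X) * p := by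
  simp only [eulerianOp, derivative_mul, derivative_X]; ring

/-- Lets the entry with i + 1 be recovered from entries with i, so that the column i = 0 satisfies a
closed recurrence in r. At r = 0 the junk index `r - 1` is harmless because its coefficient is zero.
-/
theorem eulerianOp_binomTransform_X (r i : ℕ) :
    eulerianOp (r + i) (binomTransform X eulerian r i) =
      binomTransform X eulerian r (i + 1) + (r : ℂ[X]) * X * binomTransform X eulerian (r - 1) i := by
  induction r generalizing i with
  | zero => simp [binomTransform, eulerian]
  | succ r ih =>
    have h1 := ih (i + 1)
    have h2 := ih i
    rw [show r + (i + 1) = r + 1 + i by ring] at h1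
    rw [binomTransform, eulerianOp_add, h1, eulerianOp_X_mul,
      show r + 1 + i = (r + i) + 1 by ring, eulerianOp_succ, h2]
    cases r with
    | zero => simp [binomTransform]; ring
    | succ r => simp [binomTransform]; ring

theorem eulerianOp_binomTransform_one (r i : ℕ) :
    eulerianOp (r + i) (binomTransform 1 (fun j => X * eulerian j) r i) =
      binomTransform 1 (fun j => X * eulerian j) r (i + 1) +
        (1 - X) * binomTransform 1 (fun j => X * eulerian j) r i +
        (r : ℂ[X]) * X * binomTransform 1 (fun j => X * eulerian j) (r - 1) i := by
  induction r generalizing i with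
  | zero => simp [binomTransform, eulerian, eulerianOp_X_mul]; ring
  | succ r ih =>
    have h1 := ih (i + 1)
    have h2 := ih i
    rw [show r + (i + 1) = r + 1 + i by ring] at h1
    rw [binomTransform, eulerianOp_add, h1, one_mul,
      show r + 1 + i = (r + i) + 1 by ring, eulerianOp_succ, h2]
    cases r with
    | zero => simp [binomTransform]; ring
    | succ r => simp [binomTransform]; ring

/-- Both sides satisfy the same two-term recurrence in m, obtained by eliminating the column i = 1
with the operator identities above. This is what makes the two halves of the convex path meet at p_0
= q_0. -/
theorem binomTransform_eulerian_zero (m : ℕ) :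
    binomTransform X eulerian m 0 =
      binomTransform 1 (fun j => X * eulerian j) m 0 + (1 - X) := by
  induction m using Nat.strong_induction_on with
  | _ m ih =>
    cases m with
    | zero => simp [binomTransform, eulerian]
    | succ m =>
      have h1 := eulerianOp_binomTransform_X m 0
      have h2 := eulerianOp_binomTransform_one m 0
      have e1 : eulerianOp m (1 - X) = (1 - X) * (1 - X + (m : ℂ[X]) * X) := by
        simp [eulerianOp]; ring
      have key := ih m (by omega)
      simp only [add_zero, zero_add] at h1 h2
      rw [key, eulerianOp_add, h2, e1] at h1
      rw [binomTransform, binomTransform, key]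
      cases m with
      | zero =>
        simp at h1
        linear_combination -h1
      | succ m =>
        have k2 := ih m (by omega)
        simp only [Nat.add_sub_cancel] at h1
        rw [k2] at h1
        linear_combination -h1

/-- The convolution identity that determines the Eulerian polynomials. -/
theorem sum_choose_mul_eulerian (m : ℕ) :
    ∑ j ∈ Finset.range (m + 1), (m.choose j : ℂ[X]) * (X ^ (m - j) - X) * eulerian j = 1 - X := by
  have h := binomTransform_eulerian_zero m
  rw [binomTransform_eq_sum, binomTransform_eq_sum] at h
  rw [← sub_eq_iff_eq_add', ← Finset.sum_sub_distrib] at h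
  rw [← h]
  refine Finset.sum_congr rfl fun j _ => ?_
  simp only [zero_add, one_pow]
  ring

/-! ### Degree, leading coefficient and real zeros of the Eulerian polynomials. -/

theorem natDegree_eulerian_le (m : ℕ) : (eulerian (m + 1)).natDegree ≤ m := by
  induction m with
  | zero => simp [eulerian, eulerianOp]
  | succ m ih =>
    rw [eulerian, eulerianOp]
    have hd : (derivative (eulerian (m + 1))).natDegree ≤ m - 1 :=
      (natDegree_derivative_le _).trans (Nat.sub_le_sub_right ih 1)
    have h1 : ((1 + ((m + 1 : ℕ) : ℂ[X]) * X) * eulerian (m + 1)).natDegree ≤ 1 + m := by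
      refine natDegree_mul_le_of_le ?_ ih
      compute_degree
    by_cases hm : m = 0
    · subst hm
      simp [eulerian, eulerianOp]
      compute_degree
    have h2 : (X * (1 - X) * derivative (eulerian (m + 1))).natDegree ≤ 2 + (m - 1) := by
      refine natDegree_mul_le_of_le ?_ hd
      compute_degree
    exact natDegree_add_le_of_degree_le (h1.trans (by omega)) (h2.trans (by omega))

theorem coeff_eulerian_self (m : ℕ) : (eulerian (m + 1)).coeff m = 1 := by
  induction m with
  | zero => simp [eulerian, eulerianOp]
  | succ m ih =>
    have hd := natDegree_eulerian_le m
    have hz : (eulerian (m + 1)).coeff (m + 1) = 0 :=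
      coeff_eq_zero_of_natDegree_lt (by omega)
    have e : eulerian (m + 2) = eulerian (m + 1) +
        C ((m + 1 : ℕ) : ℂ) * (eulerian (m + 1) * X) +
          (derivative (eulerian (m + 1)) * X - derivative (eulerian (m + 1)) * X * X) := by
      rw [eulerian, eulerianOp]
      simp only [map_natCast]
      ring
    rw [e]
    cases m with
    | zero => simp [coeff_one, eulerian, eulerianOp]
    | succ m =>
      simp only [coeff_add, coeff_sub, coeff_C_mul, coeff_mul_X, coeff_derivative, hz, ih]
      push_cast
      ring

theorem monic_eulerian (m : ℕ) : (eulerian (m + 1)).Monic :=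
  monic_of_natDegree_le_of_coeff_eq_one m (natDegree_eulerian_le m) (coeff_eulerian_self m)

theorem natDegree_eulerian (m : ℕ) : (eulerian (m + 1)).natDegree = m :=
  natDegree_eq_of_le_of_coeff_ne_zero (natDegree_eulerian_le m)
    (by rw [coeff_eulerian_self]; exact one_ne_zero)

theorem eval_zero_eulerian (m : ℕ) : (eulerian m).eval 0 = 1 := by
  induction m with
  | zero => simp [eulerian]
  | succ m ih => simp [eulerian, eulerianOp, ih]

/-- Divide the recurrence by A_{m+1} and expand the logarithmic derivative over the m roots, using z
+ z(1 - z)/(z - r) = (1 - r)z/(z - r). -/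
theorem eval_eulerian_add_two (m : ℕ) {z : ℂ} (hz : (eulerian (m + 1)).eval z ≠ 0) :
    (eulerian (m + 2)).eval z =
      (1 + z + ((eulerian (m + 1)).roots.map fun r => (1 - r) * z / (z - r)).sum) *
        (eulerian (m + 1)).eval z := by
  have hs := IsAlgClosed.splits (eulerian (m + 1))
  have hcard : (Multiset.card (eulerian (m + 1)).roots : ℂ) = m := by
    rw [← hs.natDegree_eq_card_roots, natDegree_eulerian]
  have hd := hs.eval_derivative_eq_eval_mul_sum hz
  have hsum : ((eulerian (m + 1)).roots.map fun r => (1 - r) * z / (z - r)).sum =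
      m * z + z * (1 - z) * ((eulerian (m + 1)).roots.map fun r => 1 / (z - r)).sum := by
    rw [← hcard, ← Multiset.sum_map_mul_left, ← nsmul_eq_mul, ← Multiset.sum_replicate,
      ← Multiset.map_const', ← Multiset.sum_map_add]
    refine congrArg Multiset.sum (Multiset.map_congr rfl fun r hr => ?_)
    have : z - r ≠ 0 := fun h => hz (by rw [sub_eq_zero.1 h]; exact isRoot_of_mem_roots hr)
    field_simp
    ring
  rw [hsum, eulerian, eulerianOp]
  simp only [eval_add, eval_mul, eval_sub, eval_one, eval_X, eval_natCast, hd]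
  push_cast
  ring

/-- For r < 0 each summand has argument between 0 and that of z when Im z > 0; the two identities
express this termwise as signs of Im S and of Im (z * conj S). -/
theorem exists_im_sum_eq (s : Multiset ℂ) (hs : ∀ r ∈ s, r.im = 0 ∧ r.re < 0) (z : ℂ) :
    ∃ a b : ℝ, 0 ≤ a ∧ 0 ≤ b ∧ (s.map fun r => (1 - r) * z / (z - r)).sum.im = z.im * a ∧
      (z * (starRingEnd ℂ) (s.map fun r => (1 - r) * z / (z - r)).sum).im = z.im * b := by
  induction s using Multiset.induction_on with
  | empty => exact ⟨0, 0, le_rfl, le_rfl, by simp, by simp⟩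
  | cons r s ih =>
    obtain ⟨a, b, ha, hb, h1, h2⟩ := ih fun r hr => hs r (Multiset.mem_cons_of_mem hr)
    obtain ⟨hr0, hr1⟩ := hs r (Multiset.mem_cons_self r s)
    have hr : r = (r.re : ℂ) := Complex.ext rfl (by simp [hr0])
    have hn := Complex.normSq_nonneg (z - r)
    refine ⟨(1 - r.re) * (-r.re) / Complex.normSq (z - r) + a,
      (1 - r.re) * Complex.normSq z / Complex.normSq (z - r) + b, ?_, ?_, ?_, ?_⟩
    · exact add_nonneg (div_nonneg (mul_nonneg (by linarith) (by linarith)) hn) ha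
    · exact add_nonneg (div_nonneg (mul_nonneg (by linarith) (Complex.normSq_nonneg z)) hn) hb
    · rw [Multiset.map_cons, Multiset.sum_cons, Complex.add_im, h1, Complex.div_im]
      simp only [Complex.mul_im, Complex.mul_re, Complex.sub_re, Complex.sub_im, Complex.one_re,
        Complex.one_im, hr0]
      ring
    · rw [Multiset.map_cons, Multiset.sum_cons, map_add, mul_add, Complex.add_im, h2]
      simp only [Complex.mul_im, Complex.mul_re, Complex.conj_re, Complex.conj_im,
        Complex.div_re, Complex.div_im, Complex.sub_re, Complex.sub_im, Complex.one_re,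
        Complex.one_im, hr0, Complex.normSq_apply z]
      ring

theorem sum_re_nonneg (s : Multiset ℂ) (hs : ∀ r ∈ s, r.im = 0 ∧ r.re < 0) {z : ℂ}
    (hz : z.im = 0) (hz' : 0 < z.re) :
    0 ≤ (s.map fun r => (1 - r) * z / (z - r)).sum.re := by
  induction s using Multiset.induction_on with
  | empty => simp
  | cons r s ih =>
    have h1 := ih fun r hr => hs r (Multiset.mem_cons_of_mem hr)
    obtain ⟨hr0, hr1⟩ := hs r (Multiset.mem_cons_self r s)
    rw [Multiset.map_cons, Multiset.sum_cons, Complex.add_re]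
    refine add_nonneg ?_ h1
    rw [Complex.div_re]
    simp only [Complex.mul_im, Complex.mul_re, Complex.sub_re, Complex.sub_im, Complex.one_re,
      Complex.one_im, hr0, hz]
    have := Complex.normSq_nonneg (z - r)
    refine add_nonneg (div_nonneg ?_ this) (by simp)
    have : 0 ≤ (1 - r.re) * z.re * (z.re - r.re) :=
      mul_nonneg (mul_nonneg (by linarith) hz'.le) (by linarith)
    linarith

/-- A new zero z satisfies 1 + z + S = 0. If z is not real, the imaginary part is (1 + a) Im z ≠ 0;
if z > 0, the real part is positive; and z = 0 is excluded by the constant term 1. -/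
theorem roots_eulerian (m : ℕ) :
    ∀ r ∈ (eulerian (m + 1)).roots, r.im = 0 ∧ r.re < 0 := by
  induction m with
  | zero => simp [eulerian, eulerianOp]
  | succ m ih =>
    intro z hz
    have hz0 : (eulerian (m + 2)).eval z = 0 := isRoot_of_mem_roots hz
    by_contra hc
    have hne : (eulerian (m + 1)).eval z ≠ 0 := fun h =>
      hc (ih z ((mem_roots (monic_eulerian m).ne_zero).2 h))
    rw [eval_eulerian_add_two m hne, mul_eq_zero, or_iff_left hne] at hz0
    obtain ⟨a, b, ha, -, h1, -⟩ := exists_im_sum_eq _ ih z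
    by_cases him : z.im = 0
    · have hre : 0 < z.re := by
        rcases lt_trichotomy z.re 0 with h | h | h
        · exact absurd ⟨him, h⟩ hc
        · have hz' : z = 0 := Complex.ext h him
          have := isRoot_of_mem_roots hz
          rw [hz', IsRoot.def, eval_zero_eulerian] at this
          exact absurd this one_ne_zero
        · exact h
      have h2 := sum_re_nonneg _ ih him hre
      have h3 := congrArg Complex.re hz0
      simp only [Complex.add_re, Complex.one_re, Complex.zero_re] at h3
      linarith
    · have h3 := congrArg Complex.im hz0
      simp only [Complex.add_im, Complex.one_im, Complex.zero_im, h1] at h3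
      have h4 : z.im * (1 + a) = 0 := by linarith
      rcases mul_eq_zero.1 h4 with h | h
      · exact him h
      · linarith

/-! ### Convex paths in the plane -/

/-- The cross product of two complex numbers, regarded as vectors in the plane. -/
def cross (a b : ℂ) : ℝ := a.re * b.im - a.im * b.re

theorem cross_add_left (a b c : ℂ) : cross (a + b) c = cross a c + cross b c := by
  simp only [cross, Complex.add_re, Complex.add_im]; ring

theorem cross_add_right (a b c : ℂ) : cross a (b + c) = cross a b + cross a c := by
  simp only [cross, Complex.add_re, Complex.add_im]; ring

theorem cross_neg_left (a b : ℂ) : cross (-a) b = -cross a b := by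
  simp only [cross, Complex.neg_re, Complex.neg_im]; ring

theorem cross_neg_right (a b : ℂ) : cross a (-b) = -cross a b := by
  simp only [cross, Complex.neg_re, Complex.neg_im]; ring

theorem cross_swap (a b : ℂ) : cross a b = -cross b a := by
  simp only [cross]; ring

theorem cross_self (a : ℂ) : cross a a = 0 := by
  simp only [cross]; ring

theorem cross_mul_mul (z a b : ℂ) : cross (z * a) (z * b) = Complex.normSq z * cross a b := by
  simp only [cross, Complex.mul_re, Complex.mul_im, Complex.normSq_apply]; ring

theorem cross_self_mul (z a : ℂ) : cross a (z * a) = z.im * Complex.normSq a := by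
  simp only [cross, Complex.mul_re, Complex.mul_im, Complex.normSq_apply]; ring

theorem cross_sum_nonneg {ι κ : Type*} {s : Finset ι} {t : Finset κ} {f : ι → ℂ} {g : κ → ℂ}
    (h : ∀ i ∈ s, ∀ j ∈ t, 0 ≤ cross (f i) (g j)) :
    0 ≤ cross (∑ i ∈ s, f i) (∑ j ∈ t, g j) := by
  classical
  have h1 : ∀ a : ℂ, cross a (∑ j ∈ t, g j) = ∑ j ∈ t, cross a (g j) := fun a => by
    induction t using Finset.induction_on with
    | empty => simp [cross]
    | insert j t hj ih =>
      rw [Finset.sum_insert hj, Finset.sum_insert hj, cross_add_right,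
        ih fun i hi k hk => h i hi k (Finset.mem_insert_of_mem hk)]
  have h2 : ∀ b : ℂ, cross (∑ i ∈ s, f i) b = ∑ i ∈ s, cross (f i) b := fun b => by
    clear h
    induction s using Finset.induction_on with
    | empty => simp [cross]
    | insert j s hj ih => rw [Finset.sum_insert hj, Finset.sum_insert hj, cross_add_left, ih]
  rw [h2]
  refine Finset.sum_nonneg fun i hi => ?_
  rw [h1]
  exact Finset.sum_nonneg fun j hj => h i hi j hj

theorem cross_sum_right_nonneg {κ : Type*} {t : Finset κ} {a : ℂ} {g : κ → ℂ}
    (h : ∀ j ∈ t, 0 ≤ cross a (g j)) : 0 ≤ cross a (∑ j ∈ t, g j) := by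
  simpa using cross_sum_nonneg (s := {()}) (f := fun _ => a) fun _ _ j hj => h j hj

/-- Cramer's rule for `z * a` in the basis `v`, `z * v`, paired with `e`. When `z * a` lies between
the basis vectors, both coefficients are positive. -/
theorem mul_cross_combination (z a v e : ℂ) :
    cross v (z * v) * cross (z * a) e =
      Complex.normSq z * cross a v * cross v e + cross v (z * a) * cross (z * v) e := by
  simp only [cross, Complex.mul_re, Complex.mul_im, Complex.normSq_apply]; ring

theorem cross_path_eq_left (v e₁ e : ℂ) :
    cross (v + e₁) (v + e₁ + e) = cross v e + cross e₁ e := by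
  simp only [cross, Complex.add_re, Complex.add_im]; ring

theorem cross_path_eq_right {v e₁ e e₂ w : ℂ} (h : v + e₁ + e + e₂ = w) :
    cross (v + e₁) (v + e₁ + e) = cross w e + cross e e₂ := by
  subst h
  simp only [cross, Complex.add_re, Complex.add_im]; ring

/-- Two vertices of a convex path from `v` to `z * v` are seen from the origin in
counterclockwise order, when all steps of the path lie in the half-plane to the left of `z * a`
and `z * a` lies between `v` and `z * v`. -/
theorem cross_path_nonneg {z a v e₁ e e₂ : ℂ} (hz : 0 < z.im) (hav : 0 < cross a v)
    (hva : 0 < cross v (z * a)) (hend : v + e₁ + e + e₂ = z * v) (h₁ : 0 ≤ cross e₁ e)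
    (h₂ : 0 ≤ cross e e₂) (he : 0 ≤ cross (z * a) e) :
    0 ≤ cross (v + e₁) (v + e₁ + e) := by
  by_contra! hc
  have hl := cross_path_eq_left v e₁ e
  have hr := cross_path_eq_right hend
  have hzn : 0 < Complex.normSq z := Complex.normSq_pos.2 fun h => by simp [h] at hz
  have hid := mul_cross_combination z a v e
  have h0 : 0 ≤ cross v (z * v) := by
    rw [cross_self_mul]; exact mul_nonneg hz.le (Complex.normSq_nonneg v)
  -- A clockwise step `e` would be to the right of both `v` and `z * v`, hence of `z * a`, against
  -- `he`.
  have p1 : Complex.normSq z * cross a v * cross v e < 0 :=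
    mul_neg_of_pos_of_neg (mul_pos hzn hav) (by linarith)
  have p2 : cross v (z * a) * cross (z * v) e < 0 :=
    mul_neg_of_pos_of_neg hva (by linarith)
  have p3 := mul_nonneg h0 he
  linarith

theorem cross_path_pos {z a v e₁ e e₂ : ℂ} (hz : 0 < z.im) (hav : 0 < cross a v)
    (hva : 0 < cross v (z * a)) (hend : v + e₁ + e + e₂ = z * v) (h₁ : 0 ≤ cross e₁ e)
    (h₂ : 0 ≤ cross e e₂) (he : 0 < cross (z * a) e) :
    0 < cross (v + e₁) (v + e₁ + e) := by
  by_contra! hc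
  have hl := cross_path_eq_left v e₁ e
  have hr := cross_path_eq_right hend
  have hid := mul_cross_combination z a v e
  have h0 : 0 < cross v (z * v) := by
    rw [cross_self_mul]
    refine mul_pos hz (Complex.normSq_pos.2 fun h => ?_)
    simp [h, cross] at hav
  have p1 : Complex.normSq z * cross a v * cross v e ≤ 0 :=
    mul_nonpos_of_nonneg_of_nonpos (mul_nonneg (Complex.normSq_nonneg z) hav.le) (by linarith)
  have p2 : cross v (z * a) * cross (z * v) e ≤ 0 :=
    mul_nonpos_of_nonneg_of_nonpos hva.le (by linarith)
  have p3 := mul_pos h0 he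
  linarith

theorem exists_eq_combination {z v p : ℂ} (hz : 0 < z.im) (hv : v ≠ 0) (h₁ : 0 ≤ cross v p)
    (h₂ : 0 ≤ cross p (z * v)) :
    ∃ a b : ℝ, 0 ≤ a ∧ 0 ≤ b ∧ p = a * v + b * (z * v) := by
  have h0 : 0 < cross v (z * v) := by
    rw [cross_self_mul]; exact mul_pos hz (Complex.normSq_pos.2 hv)
  refine ⟨cross p (z * v) / cross v (z * v), cross v p / cross v (z * v),
    div_nonneg h₂ h0.le, div_nonneg h₁ h0.le, ?_⟩
  have hid : (cross v (z * v) : ℂ) * p = cross p (z * v) * v + cross v p * (z * v) := by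
    apply Complex.ext <;>
    · simp only [cross, Complex.mul_re, Complex.mul_im, Complex.add_re, Complex.add_im,
        Complex.ofReal_re, Complex.ofReal_im]
      ring
  have hne : (cross v (z * v) : ℂ) ≠ 0 := by exact_mod_cast h0.ne'
  push_cast
  field_simp
  linear_combination hid

/-- If `q` precedes `p` in the cone spanned by `v` and `z * v`, then `p` precedes `z * q`. -/
theorem cross_mul_nonneg_of_cross_nonneg {z v p q : ℂ} (hz : 0 < z.im) (hv : v ≠ 0)
    (hp₁ : 0 ≤ cross v p) (hp₂ : 0 ≤ cross p (z * v)) (hq₁ : 0 ≤ cross v q)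
    (hq₂ : 0 ≤ cross q (z * v)) (hqp : 0 ≤ cross q p) : 0 ≤ cross p (z * q) := by
  obtain ⟨a, b, ha, hb, rfl⟩ := exists_eq_combination hz hv hp₁ hp₂
  obtain ⟨c, d, hc, hd, rfl⟩ := exists_eq_combination hz hv hq₁ hq₂
  have hn : 0 < z.im * Complex.normSq v := mul_pos hz (Complex.normSq_pos.2 hv)
  have e1 : cross (c * v + d * (z * v)) (a * v + b * (z * v)) =
      (z.im * Complex.normSq v) * (b * c - a * d) := by
    simp only [cross, Complex.mul_re, Complex.mul_im, Complex.add_re, Complex.add_im,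
        Complex.ofReal_re, Complex.ofReal_im, Complex.normSq_apply]
    ring
  have e2 : cross (a * v + b * (z * v)) (z * (c * v + d * (z * v))) =
      (z.im * Complex.normSq v) *
        (a * c + 2 * z.re * (a * d) + b * d * (z.re ^ 2 + z.im ^ 2)) := by
    simp only [cross, Complex.mul_re, Complex.mul_im, Complex.add_re, Complex.add_im,
        Complex.ofReal_re, Complex.ofReal_im, Complex.normSq_apply]
    ring
  rw [e1] at hqp
  have hle : 0 ≤ b * c - a * d := nonneg_of_mul_nonneg_right hqp hn
  rw [e2]
  refine mul_nonneg hn.le ?_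
  -- `z.re` may be negative. Since a d ≤ b c, the quadratic in `z.re` has nonpositive discriminant;
  -- multiplying by b d completes a square, and b d = 0 forces a d = 0.
  have hx : 0 ≤ a * c + 2 * z.re * (a * d) + b * d * z.re ^ 2 := by
    rcases (mul_nonneg hb hd).eq_or_lt with h | h
    · have : a * d = 0 := by
        rcases mul_eq_zero.1 h.symm with h | h
        · subst h
          have := mul_nonneg ha hd
          linarith
        · simp [h]
      rw [← h, this]
      have := mul_nonneg ha hc
      linarith
    · have h1 : (a * d) ^ 2 ≤ (b * d) * (a * c) := by
        have := mul_nonneg (mul_nonneg ha hd) hle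
        nlinarith
      have h2 : 0 ≤ (b * d) * (a * c + 2 * z.re * (a * d) + b * d * z.re ^ 2) := by
        nlinarith [sq_nonneg (b * d * z.re + a * d)]
      exact nonneg_of_mul_nonneg_right h2 h
  have := mul_nonneg (mul_nonneg hb hd) (sq_nonneg z.im)
  linarith

/-! ### Interlacing at a point of the upper half-plane -/

/-- The values `p m, …, p 0 = q 0, …, q m = z * p m` occur in counterclockwise order. -/
structure IsConvexPair (z : ℂ) (m : ℕ) (p q : ℕ → ℂ) : Prop where
  zero_eq : p 0 = q 0
  last_eq : q m = z * p m
  left : ∀ i j, i ≤ j → j ≤ m → 0 ≤ cross (p j) (p i)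
  mid : ∀ i j, i ≤ m → j ≤ m → 0 ≤ cross (p j) (q i)
  right : ∀ i j, i ≤ j → j ≤ m → 0 ≤ cross (q i) (q j)
  pos : 0 < cross (p m) (p 0)

/-- All the points lie in the cone from `p m` to `z * p m`, and `p j` precedes `q i` there, so `q i`
precedes `z * p j`. -/
theorem IsConvexPair.cross_mul_nonneg {z : ℂ} {m : ℕ} {p q : ℕ → ℂ} (h : IsConvexPair z m p q)
    (hz : 0 < z.im) {i j : ℕ} (hi : i ≤ m) (hj : j ≤ m) : 0 ≤ cross (q i) (z * p j) := by
  have hv : p m ≠ 0 := fun h0 => by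
    have := h.pos
    simp [h0, cross] at this
  refine cross_mul_nonneg_of_cross_nonneg hz hv (h.mid i m hi le_rfl) ?_ (h.left j m hj le_rfl) ?_
    (h.mid i j hi hj)
  · rw [← h.last_eq]; exact h.right i m hi le_rfl
  · rw [← h.last_eq]; exact h.mid m j le_rfl hj

theorem eq_add_sum_Ico {f g : ℕ → ℂ} {m : ℕ} (h : ∀ i ≤ m, f i = f (i + 1) + g i) {i j : ℕ}
    (hij : i ≤ j) (hj : j ≤ m + 1) : f i = f j + ∑ l ∈ Finset.Ico i j, g l := by
  induction j, hij using Nat.le_induction with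
  | base => simp
  | succ j hij ih =>
    rw [Finset.sum_Ico_succ_top hij, ih (by omega), h j (by omega)]
    ring

/-- The path from `p' (m + 1)` to `z * p' (m + 1)` has steps z p_m, ..., z p_0, -q_0, ..., -q_m = -z
p_m. These turn counterclockwise through a half-turn and stay to the left of z p_m, so
`cross_path_nonneg` applies with a = p_m to any two vertices. -/
theorem IsConvexPair.step {z : ℂ} {m : ℕ} {p q p' q' : ℕ → ℂ} (h : IsConvexPair z m p q)
    (hz : 0 < z.im) (h0 : p' 0 = q' 0) (hlast : q' (m + 1) = z * p' (m + 1))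
    (hp : ∀ i ≤ m, p' i = p' (i + 1) + z * p i) (hq : ∀ i ≤ m, q' i = q' (i + 1) + q i)
    (hav : 0 < cross (p m) (p' (m + 1))) (hva : 0 < cross (p' (m + 1)) (z * p m)) :
    IsConvexPair z (m + 1) p' q' := by
  have hzn : 0 ≤ Complex.normSq z := Complex.normSq_nonneg z
  -- cross products of sums of steps
  have cpp : ∀ i₁ j₁ i₂ j₂, j₂ ≤ i₁ → j₁ ≤ m + 1 →
      0 ≤ cross (∑ l ∈ Finset.Ico i₁ j₁, z * p l) (∑ l ∈ Finset.Ico i₂ j₂, z * p l) := by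
    intro i₁ j₁ i₂ j₂ h₁ h₂
    refine cross_sum_nonneg fun i hi j hj => ?_
    rw [Finset.mem_Ico] at hi hj
    rw [cross_mul_mul]
    exact mul_nonneg hzn (h.left j i (by omega) (by omega))
  have cqq : ∀ i₁ j₁ i₂ j₂, j₁ ≤ i₂ → j₂ ≤ m + 1 →
      0 ≤ cross (∑ l ∈ Finset.Ico i₁ j₁, q l) (∑ l ∈ Finset.Ico i₂ j₂, q l) := by
    intro i₁ j₁ i₂ j₂ h₁ h₂
    refine cross_sum_nonneg fun i hi j hj => ?_
    rw [Finset.mem_Ico] at hi hj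
    exact h.right i j (by omega) (by omega)
  have cqp : ∀ i₁ j₁ i₂ j₂, j₁ ≤ m + 1 → j₂ ≤ m + 1 →
      0 ≤ cross (∑ l ∈ Finset.Ico i₁ j₁, q l) (∑ l ∈ Finset.Ico i₂ j₂, z * p l) := by
    intro i₁ j₁ i₂ j₂ h₁ h₂
    refine cross_sum_nonneg fun i hi j hj => ?_
    rw [Finset.mem_Ico] at hi hj
    exact h.cross_mul_nonneg hz (by omega) (by omega)
  have cap : ∀ i j, j ≤ m + 1 → 0 ≤ cross (z * p m) (∑ l ∈ Finset.Ico i j, z * p l) := by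
    intro i j hj
    refine cross_sum_right_nonneg fun l hl => ?_
    rw [Finset.mem_Ico] at hl
    rw [cross_mul_mul]
    exact mul_nonneg hzn (h.left l m (by omega) le_rfl)
  have caq : ∀ i j, j ≤ m + 1 → 0 ≤ cross (z * p m) (-∑ l ∈ Finset.Ico i j, q l) := by
    intro i j hj
    rw [← Finset.sum_neg_distrib]
    refine cross_sum_right_nonneg fun l hl => ?_
    rw [Finset.mem_Ico] at hl
    rw [← h.last_eq, cross_neg_right, cross_swap, neg_neg]
    exact h.right l m (by omega) le_rfl
  have ep : ∀ i j, i ≤ j → j ≤ m + 1 → p' i = p' j + ∑ l ∈ Finset.Ico i j, z * p l :=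
    fun i j hij hj => eq_add_sum_Ico hp hij hj
  have eq : ∀ i j, i ≤ j → j ≤ m + 1 → q' i = q' j + ∑ l ∈ Finset.Ico i j, q l :=
    fun i j hij hj => eq_add_sum_Ico hq hij hj
  refine ⟨h0, hlast, ?_, ?_, ?_, ?_⟩
  · intro i j hij hj
    have e1 := ep j (m + 1) hj le_rfl
    have e2 := ep i j hij hj
    have e3 := ep 0 i (Nat.zero_le i) (hij.trans hj)
    have e4 := eq 0 (m + 1) (Nat.zero_le _) le_rfl
    -- The path is cut at the two vertices being compared: e₁ leads from the start to the earlier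
    -- one, e joins them, and e₂ runs on to the end.
    have key := cross_path_nonneg (e₁ := ∑ l ∈ Finset.Ico j (m + 1), z * p l)
      (e := ∑ l ∈ Finset.Ico i j, z * p l)
      (e₂ := (∑ l ∈ Finset.Ico 0 i, z * p l) + -∑ l ∈ Finset.Ico 0 (m + 1), q l) hz hav hva
      (by linear_combination hlast - e1 - e2 - e3 + e4 + h0) (cpp _ _ _ _ le_rfl le_rfl) ?_
      (cap _ _ hj)
    · rwa [← e1, ← e2] at key
    · rw [cross_add_right, cross_neg_right, cross_swap _ (∑ l ∈ Finset.Ico 0 (m + 1), q l), neg_neg]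
      exact add_nonneg (cpp _ _ _ _ le_rfl hj) (cqp _ _ _ _ le_rfl hj)
  · intro i j hi hj
    have e1 := ep j (m + 1) hj le_rfl
    have e2 := ep 0 j (Nat.zero_le j) hj
    have e3 := eq 0 i (Nat.zero_le i) hi
    have e4 := eq i (m + 1) hi le_rfl
    have e5 : q' i = p' j +
        ((∑ l ∈ Finset.Ico 0 j, z * p l) + -∑ l ∈ Finset.Ico 0 i, q l) := by
      linear_combination -e3 + e2 - h0
    have key := cross_path_nonneg (e₁ := ∑ l ∈ Finset.Ico j (m + 1), z * p l)
      (e := (∑ l ∈ Finset.Ico 0 j, z * p l) + -∑ l ∈ Finset.Ico 0 i, q l)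
      (e₂ := -∑ l ∈ Finset.Ico i (m + 1), q l) hz hav hva
      (by linear_combination hlast - e1 + e4 - e5) ?_ ?_ ?_
    · rwa [← e1, ← e5] at key
    · rw [cross_add_right, cross_neg_right, cross_swap _ (∑ l ∈ Finset.Ico 0 i, q l), neg_neg]
      exact add_nonneg (cpp _ _ _ _ le_rfl le_rfl) (cqp _ _ _ _ hi le_rfl)
    · rw [cross_neg_right, cross_swap, neg_neg, cross_add_right, cross_neg_right,
        cross_swap _ (∑ l ∈ Finset.Ico 0 i, q l), neg_neg]
      exact add_nonneg (cqp _ _ _ _ le_rfl hj) (cqq _ _ _ _ le_rfl le_rfl)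
    · rw [cross_add_right]
      exact add_nonneg (cap _ _ hj) (caq _ _ hi)
  · intro i j hij hj
    have e1 := ep 0 (m + 1) (Nat.zero_le _) le_rfl
    have e2 := eq 0 i (Nat.zero_le i) (hij.trans hj)
    have e3 := eq i j hij hj
    have e4 := eq j (m + 1) hj le_rfl
    have e5 : q' i = p' (m + 1) +
        ((∑ l ∈ Finset.Ico 0 (m + 1), z * p l) + -∑ l ∈ Finset.Ico 0 i, q l) := by
      linear_combination -e2 + e1 - h0
    have e6 : q' j = q' i + -∑ l ∈ Finset.Ico i j, q l := by
      linear_combination -e3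
    have key := cross_path_nonneg
      (e₁ := (∑ l ∈ Finset.Ico 0 (m + 1), z * p l) + -∑ l ∈ Finset.Ico 0 i, q l)
      (e := -∑ l ∈ Finset.Ico i j, q l)
      (e₂ := -∑ l ∈ Finset.Ico j (m + 1), q l) hz hav hva
      (by linear_combination hlast - e5 - e6 + e4) ?_ ?_ (caq _ _ hj)
    · rwa [← e5, ← e6] at key
    · rw [cross_neg_right, cross_swap, neg_neg, cross_add_right, cross_neg_right,
        cross_swap _ (∑ l ∈ Finset.Ico 0 i, q l), neg_neg]
      exact add_nonneg (cqp _ _ _ _ hj le_rfl) (cqq _ _ _ _ le_rfl hj)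
    · rw [cross_neg_left, cross_neg_right, neg_neg]
      exact cqq _ _ _ _ le_rfl le_rfl
  · have e1 := ep 0 (m + 1) (Nat.zero_le _) le_rfl
    have e2 := eq 0 (m + 1) (Nat.zero_le _) le_rfl
    have key := cross_path_pos (e₁ := 0) (e := ∑ l ∈ Finset.Ico 0 (m + 1), z * p l)
      (e₂ := -∑ l ∈ Finset.Ico 0 (m + 1), q l) hz hav hva
      (by linear_combination hlast - e1 + e2 + h0) (by simp [cross]) ?_ ?_
    · rwa [add_zero, ← e1] at key
    · rw [cross_neg_right, cross_swap, neg_neg]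
      exact cqp _ _ _ _ le_rfl le_rfl
    -- Strictness comes from the single step z p_0, which is strictly to the left of z p_m by
    -- `h.pos`.
    · rw [Finset.sum_eq_sum_Ico_succ_bot (Nat.succ_pos m), cross_add_right, cross_mul_mul]
      have hzp : 0 < Complex.normSq z := Complex.normSq_pos.2 fun h => by simp [h] at hz
      exact add_pos_of_pos_of_nonneg (mul_pos hzp h.pos) (cap 1 (m + 1) le_rfl)

/-! ### The Chow function without the Möbius function -/

theorem sum_Icc_sum_Icc_comm {P M : Type*} [PartialOrder P] [LocallyFiniteOrder P]
    [AddCommMonoid M] (x y : P) (f : P → P → M) :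
    ∑ w ∈ Finset.Icc x y, ∑ z ∈ Finset.Icc w y, f w z =
      ∑ z ∈ Finset.Icc x y, ∑ w ∈ Finset.Icc x z, f w z := by
  refine Finset.sum_comm' fun w z => ?_
  simp only [Finset.mem_Icc]
  constructor
  · rintro ⟨⟨h1, h2⟩, h3, h4⟩
    exact ⟨⟨h1, h3⟩, h1.trans h3, h4⟩
  · rintro ⟨⟨h1, h2⟩, h3, h4⟩
    exact ⟨⟨h1, h2.trans h4⟩, h2, h4⟩

theorem rank_eq_of_strictMono {P : Type*} [PartialOrder P] {r : P → ℕ}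
    (hr : StrictMono r) (hex : ∀ x, r x ≠ 0 → ∃ y < x, r y + 1 = r x) (x : P) : rank x = r x := by
  suffices h : Order.height x = r x by rw [rank, h, ENat.toNat_natCast]
  have hlow : ∀ m x, r x = m → (m : ℕ∞) ≤ Order.height x := by
    intro m
    induction m with
    | zero => simp
    | succ m ih =>
      intro x hx
      obtain ⟨y, hy, hyr⟩ := hex x (by omega)
      have h1 := Order.height_add_one_le hy
      have h2 := ih y (by omega)
      push_cast
      exact (add_le_add_left h2 1).trans h1
  refine le_antisymm ?_ (hlow _ x rfl)
  have := Order.height_le_height_apply_of_strictMono r hr x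
  simpa using this

section Poset

variable {P : Type*} [PartialOrder P] [LocallyFiniteOrder P] [DecidableEq P]

theorem charPoly_self (x : P) : charPoly x x = 1 := by
  simp [charPoly]

theorem X_sub_one_mul_redCharPoly {x y : P} (h : x ≠ y) :
    (X - 1) * redCharPoly x y = charPoly x y := by
  rw [redCharPoly, if_neg h, ← C_1, mul_divByMonic_eq_iff_isRoot, IsRoot.def, charPoly,
    eval_finsetSum]
  have := IncidenceAlgebra.sum_Icc_mu_right (𝕜 := ℤ) x y
  rw [if_neg h] at this
  simpa using this

/-- The defining recurrence of H multiplied by X - 1; the correction on the diagonal accounts for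
the convention -1 for trivial intervals. -/
theorem sum_charPoly_mul_chow {x y : P} (h : x ≤ y) :
    ∑ z ∈ Finset.Icc x y, charPoly x z * chow z y =
      X * chow x y + if x = y then 1 - X else 0 := by
  by_cases hxy : x = y
  · subst hxy
    simp [charPoly_self, chow_self]
  · rw [if_neg hxy, ← Finset.Ioc_insert_left h, Finset.sum_insert (by simp), charPoly_self]
    have h1 : ∑ z ∈ Finset.Ioc x y, charPoly x z * chow z y = (X - 1) * chow x y := by
      rw [chow_of_ne hxy, Finset.mul_sum]
      refine Finset.sum_congr rfl fun z hz => ?_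
      rw [← X_sub_one_mul_redCharPoly (Finset.mem_Ioc.1 hz).1.ne, mul_assoc]
    rw [h1]
    ring

theorem sum_charPoly {x y : P} (h : x ≤ y) :
    ∑ w ∈ Finset.Icc x y, charPoly w y = X ^ (rank y - rank x) := by
  simp only [charPoly]
  rw [sum_Icc_sum_Icc_comm]
  simp only [← Finset.sum_mul, ← map_sum, IncidenceAlgebra.sum_Icc_mu_left]
  rw [Finset.sum_eq_single_of_mem x (Finset.left_mem_Icc.2 h)]
  · simp
  · intro z _ hz
    rw [if_neg hz.symm, map_zero, zero_mul]

/-- The augmented Chow function as a sum of Chow functions. -/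
theorem augChow_eq {x y : P} (h : x ≤ y) :
    augChow x y = X * ∑ z ∈ Finset.Icc x y, chow z y + (1 - X) := by
  -- Summing `charPoly w z` over the lower endpoint w cancels the Möbius function and leaves the
  -- power of X in `augChow`.
  have h1 : augChow x y = ∑ w ∈ Finset.Icc x y, ∑ z ∈ Finset.Icc w y, charPoly w z * chow z y := by
    rw [sum_Icc_sum_Icc_comm, augChow]
    refine Finset.sum_congr rfl fun z hz => ?_
    rw [← sum_charPoly (Finset.mem_Icc.1 hz).1, Finset.sum_mul]
  rw [h1, Finset.sum_congr rfl fun w hw => sum_charPoly_mul_chow (Finset.mem_Icc.1 hw).2,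
    Finset.sum_add_distrib, Finset.mul_sum, Finset.sum_ite_eq' _ y fun _ => (1 - X : ℤ[X]),
    if_pos (Finset.right_mem_Icc.2 h)]

theorem one_sub_X_mul_chow {x y : P} (h : x ≤ y) :
    (1 - X) * chow x y =
      (1 - X) + ∑ z ∈ Finset.Ioc x y, (X - X ^ (rank z - rank x)) * chow z y := by
  have h1 := augChow_eq h
  rw [augChow, ← Finset.Ioc_insert_left h, Finset.sum_insert (by simp),
    Finset.sum_insert (by simp)] at h1
  simp only [sub_mul, Finset.sum_sub_distrib, ← Finset.mul_sum]
  simp only [Nat.sub_self, pow_zero] at h1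
  linear_combination h1

end Poset

/-! ### The dual of the uniform lattice -/

section Uniform

variable {k n : ℕ}

theorem mem_uniformFinset (hkn : k ≤ n) {A : Finset (Fin n)} :
    A ∈ uniformFinset k n ↔ A.card < k ∨ A = Finset.univ := by
  rw [uniformFinset, mem_truncation_iterate, Nat.sub_sub_self hkn]

/-- The rank function of the dual of the uniform lattice. -/
def corank (k : ℕ) (x : (UniformLattice k n)ᵒᵈ) : ℕ :=
  if (OrderDual.ofDual x).1 = Finset.univ then 0 else k - (OrderDual.ofDual x).1.card

theorem corank_strictMono (hkn : k ≤ n) :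
    StrictMono (corank k : (UniformLattice k n)ᵒᵈ → ℕ) := by
  intro x y hxy
  have hlt : (OrderDual.ofDual y).1 ⊂ (OrderDual.ofDual x).1 := hxy
  have hy : (OrderDual.ofDual y).1 ≠ Finset.univ := fun h =>
    hlt.2 (h ▸ Finset.subset_univ _)
  have hyc := ((mem_uniformFinset hkn).1 (OrderDual.ofDual y).2).resolve_right hy
  have hc := Finset.card_lt_card hlt
  rw [corank, corank, if_neg hy]
  split_ifs with hx
  · omega
  · have hxc := ((mem_uniformFinset hkn).1 (OrderDual.ofDual x).2).resolve_right hx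
    omega

theorem exists_corank (hkn : k ≤ n) (x : (UniformLattice k n)ᵒᵈ) (hx : corank k x ≠ 0) :
    ∃ y < x, corank k y + 1 = corank k x := by
  have hu : (OrderDual.ofDual x).1 ≠ Finset.univ := fun h => hx (if_pos h)
  have hc := ((mem_uniformFinset hkn).1 (OrderDual.ofDual x).2).resolve_right hu
  by_cases hk : (OrderDual.ofDual x).1.card + 1 = k
  · refine ⟨OrderDual.toDual ⟨Finset.univ, univ_mem_uniformFinset k n⟩, ?_, ?_⟩
    · exact Finset.ssubset_univ_iff.2 hu
    · rw [corank, corank, if_neg hu, if_pos (by rfl)]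
      omega
  · obtain ⟨a, ha⟩ : ∃ a, a ∉ (OrderDual.ofDual x).1 := by
      by_contra! h
      exact hu (Finset.eq_univ_iff_forall.2 h)
    have hcard := Finset.card_insert_of_notMem ha
    refine ⟨OrderDual.toDual ⟨insert a (OrderDual.ofDual x).1,
      (mem_uniformFinset hkn).2 (Or.inl (by omega))⟩, Finset.ssubset_insert ha, ?_⟩
    have hne : insert a (OrderDual.ofDual x).1 ≠ Finset.univ := fun h => by
      rw [h, Finset.card_univ, Fintype.card_fin] at hcard
      omega
    rw [corank, corank, if_neg hu, if_neg (by exact hne)]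
    simp only [OrderDual.ofDual_toDual]
    omega

theorem rank_dual_uniformLattice (hkn : k ≤ n) (x : (UniformLattice k n)ᵒᵈ) :
    rank x = corank k x :=
  rank_eq_of_strictMono (corank_strictMono hkn) (exists_corank hkn) x

end Uniform

/-! ### Nonvanishing in the upper half-plane -/

theorem binomTransform_shift {R : Type*} [CommRing R] (w : R) (u : ℕ → R) (r i : ℕ) :
    binomTransform w u r (i + 1) = binomTransform w (fun j => u (j + 1)) r i := by
  induction r generalizing i with
  | zero => rfl
  | succ r ih => rw [binomTransform, binomTransform, ih, ih]

/-- Pascal's rule on both sides, by induction on e and then m. It turns a binomial sum for n = m + e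
truncated at j ≤ m into a nonnegative combination of complete binomial transforms. -/
theorem sum_multichoose_mul_binomTransform {R : Type*} [CommRing R] (w : R) (u : ℕ → R)
    (e m : ℕ) :
    ∑ i ∈ Finset.range (m + 1), (e.multichoose i : R) * binomTransform w u (m - i) i =
      ∑ j ∈ Finset.range (m + 1), ((m + e).choose j : R) * w ^ (m - j) * u j := by
  induction e generalizing m u with
  | zero =>
    rw [Finset.sum_range_succ']
    simp [Nat.multichoose_zero_succ, binomTransform_eq_sum]
  | succ e ihe =>
    induction m generalizing u with
    | zero => simp [binomTransform]
    | succ m ihm =>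
      have h1 := ihe u (m + 1)
      have h2 := ihm fun j => u (j + 1)
      rw [Finset.sum_range_succ'] at h1 ⊢
      rw [Finset.sum_range_succ' (fun j => ((m + 1 + e).choose j : R) * w ^ (m + 1 - j) * u j)] at h1
      rw [Finset.sum_range_succ'
        (fun j => ((m + 1 + (e + 1)).choose j : R) * w ^ (m + 1 - j) * u j)]
      simp only [Nat.multichoose_succ_succ, Nat.cast_add, add_mul, Finset.sum_add_distrib,
        binomTransform_shift, Nat.add_sub_add_right, Nat.multichoose_zero_right,
        Nat.choose_zero_right, ← add_assoc, Nat.choose_succ_succ] at h1 h2 ⊢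
      rw [show m + 1 + e = m + e + 1 by ring] at h1 ⊢
      linear_combination h1 + h2

section Point

variable {z : ℂ}

theorem eval_eulerian_ne_zero (hz : z.im ≠ 0) (m : ℕ) : (eulerian (m + 1)).eval z ≠ 0 := fun h =>
  hz (roots_eulerian m z ((mem_roots (monic_eulerian m).ne_zero).2 h)).1

/-- The ratio R = A_{m+2}(z)/A_{m+1}(z) = 1 + z + S has Im R > 0 and Im (z * conj R) > 0, so its
argument lies strictly between 0 and that of z. -/
theorem cross_eulerian_pos (hz : 0 < z.im) (m : ℕ) :
    0 < cross ((eulerian (m + 1)).eval z) ((eulerian (m + 2)).eval z) ∧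
      0 < cross ((eulerian (m + 2)).eval z) (z * (eulerian (m + 1)).eval z) := by
  have hne := eval_eulerian_ne_zero hz.ne' m
  have hn := Complex.normSq_pos.2 hne
  obtain ⟨a, b, ha, hb, h1, h2⟩ := exists_im_sum_eq _ (roots_eulerian m) z
  rw [eval_eulerian_add_two m hne]
  generalize ((eulerian (m + 1)).roots.map fun r => (1 - r) * z / (z - r)).sum = S at *
  generalize (eulerian (m + 1)).eval z = v at *
  constructor
  · rw [cross_self_mul]
    refine mul_pos ?_ hn
    simp only [Complex.add_im, Complex.one_im, h1]
    have := mul_nonneg hz.le ha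
    linarith
  · have e : cross ((1 + z + S) * v) (z * v) =
        Complex.normSq v * (z.im + (z * (starRingEnd ℂ) S).im) := by
      simp only [cross, Complex.mul_re, Complex.mul_im, Complex.add_re, Complex.add_im,
        Complex.one_re, Complex.one_im, Complex.conj_re, Complex.conj_im, Complex.normSq_apply]
      ring
    rw [e, h2]
    have := mul_nonneg hz.le hb
    exact mul_pos hn (by linarith)

/-- The values at `z` of the polynomials `∑ l, (m - i).choose l * X ^ (m - i - l) * A (i + l)`. -/
noncomputable def lowerValue (z : ℂ) (m i : ℕ) : ℂ :=
  binomTransform z (fun j => (eulerian j).eval z) (m - i) i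

/-- The values at `z` of the reversals of the polynomials evaluated in `lowerValue`. -/
noncomputable def upperValue (z : ℂ) (m i : ℕ) : ℂ :=
  binomTransform 1 (fun j => z * (eulerian j).eval z) (m - i) i + if i = 0 then 1 - z else 0

theorem lowerValue_zero (z : ℂ) (m : ℕ) : lowerValue z m 0 = upperValue z m 0 := by
  have h := congrArg (evalRingHom z) (binomTransform_eulerian_zero m)
  rw [map_add, map_binomTransform, map_binomTransform] at h
  simpa [lowerValue, upperValue] using h

theorem isConvexPair_lowerValue_upperValue (hz : 0 < z.im) (m : ℕ) :
    IsConvexPair z (m + 1) (lowerValue z (m + 1)) (upperValue z (m + 1)) := by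
  induction m with
  | zero =>
    have a0 : lowerValue z 1 0 = 1 + z := by
      simp [lowerValue, binomTransform, eulerian, eulerianOp]
    have a1 : lowerValue z 1 1 = 1 := by
      simp [lowerValue, binomTransform, eulerian, eulerianOp]
    have b0 : upperValue z 1 0 = 1 + z := by rw [← lowerValue_zero, a0]
    have b1 : upperValue z 1 1 = z := by
      simp [upperValue, binomTransform, eulerian, eulerianOp]
    -- The path is 1, 1 + z, z. The induction starts here because a path with m = 0 cannot satisfy
    -- the strict condition `pos`.
    refine ⟨by rw [zero_add, a0, b0], by simp [a1, b1], ?_, ?_, ?_, ?_⟩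
    · intro i j hij hj
      interval_cases j <;> interval_cases i <;> simp [a0, a1, cross] <;> nlinarith
    · intro i j hi hj
      interval_cases j <;> interval_cases i <;> simp [a0, a1, b0, b1, cross] <;> nlinarith
    · intro i j hij hj
      interval_cases j <;> interval_cases i <;> simp [b0, b1, cross] <;> nlinarith
    · simpa [a0, a1, cross] using hz
  | succ m ih =>
    have hl : ∀ m, lowerValue z m m = (eulerian m).eval z := fun m => by
      simp [lowerValue, binomTransform]
    refine ih.step hz (lowerValue_zero z _) ?_ ?_ ?_ ?_ ?_
    · simp [lowerValue, upperValue, binomTransform]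
    · intro i hi
      rw [lowerValue, lowerValue, lowerValue, show m + 1 + 1 - i = m + 1 - i + 1 by omega,
        binomTransform, Nat.add_sub_add_right]
    · intro i hi
      rw [upperValue, upperValue, upperValue, show m + 1 + 1 - i = m + 1 - i + 1 by omega,
        binomTransform, Nat.add_sub_add_right, if_neg (Nat.succ_ne_zero i)]
      ring
    · rw [hl, hl]; exact (cross_eulerian_pos hz m).1
    · rw [hl, hl]; exact (cross_eulerian_pos hz m).2

/-- `(1 - z)` times the value at `z` of the Chow polynomial of the dual of `U_{K,n}`. -/
noncomputable def chowValue (z : ℂ) (K n : ℕ) : ℂ :=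
  (1 - z) + ∑ j ∈ Finset.range K, (n.choose j : ℂ) * ((z - z ^ (K - j)) * (eulerian j).eval z)

theorem chowValue_self (z : ℂ) (m : ℕ) : chowValue z m m = (1 - z) * (eulerian m).eval z := by
  have h := congrArg (eval z) (sum_choose_mul_eulerian m)
  rw [Finset.sum_range_succ, eval_add, eval_finsetSum] at h
  simp only [eval_mul, eval_natCast, eval_sub, eval_pow, eval_X, eval_one, Nat.choose_self,
    Nat.sub_self, pow_zero, Nat.cast_one, one_mul] at h
  have h2 : ∑ j ∈ Finset.range m, (m.choose j : ℂ) * ((z - z ^ (m - j)) * (eulerian j).eval z) =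
      -∑ j ∈ Finset.range m, (m.choose j : ℂ) * (z ^ (m - j) - z) * (eulerian j).eval z := by
    rw [← Finset.sum_neg_distrib]
    exact Finset.sum_congr rfl fun j _ => by ring
  rw [chowValue, h2]
  linear_combination -h

theorem chowValue_eq (z : ℂ) (m e : ℕ) :
    chowValue z (m + 1) (m + e) =
      ∑ i ∈ Finset.range (m + 1), (e.multichoose i : ℂ) * upperValue z m i -
        z * ∑ i ∈ Finset.range (m + 1), (e.multichoose i : ℂ) * lowerValue z m i := by
  simp only [upperValue, lowerValue, mul_add, Finset.sum_add_distrib,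
    sum_multichoose_mul_binomTransform]
  simp only [mul_ite, mul_zero, Finset.sum_ite_eq', Finset.mem_range, Nat.succ_pos, if_true,
    Nat.multichoose_zero_right, Nat.cast_one, one_mul, one_pow, mul_one, Finset.mul_sum]
  rw [add_sub_right_comm, ← Finset.sum_sub_distrib, add_comm _ (1 - z), chowValue]
  congr 1
  refine Finset.sum_congr rfl fun j hj => ?_
  rw [show m + 1 - j = m - j + 1 by have := Finset.mem_range.1 hj; omega, pow_succ]
  ring

theorem chowValue_ne_zero (hz : 0 < z.im) {K n : ℕ} (hK : K ≤ n + 1) : chowValue z K n ≠ 0 := by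
  have h1z : (1 - z) ≠ 0 := fun h => by
    have := congrArg Complex.im h
    simp at this
    exact hz.ne' this
  match K, hK with
  | 0, _ => simpa [chowValue] using h1z
  | 1, _ => simpa [chowValue] using h1z
  | m + 2, hK =>
    obtain ⟨e, rfl⟩ := Nat.exists_eq_add_of_le (show m + 1 ≤ n by omega)
    rw [chowValue_eq]
    have hc := isConvexPair_lowerValue_upperValue hz m
    generalize lowerValue z (m + 1) = p at *
    generalize upperValue z (m + 1) = q at *
    have hnn : ∀ s t : Finset ℕ, s ⊆ Finset.range (m + 1 + 1) → t ⊆ Finset.range (m + 1 + 1) →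
        0 ≤ cross (∑ i ∈ s, (e.multichoose i : ℂ) * q i)
          (∑ i ∈ t, z * ((e.multichoose i : ℂ) * p i)) := by
      intro s t hs ht
      refine cross_sum_nonneg fun i hi j hj => ?_
      have hi' := Finset.mem_range.1 (hs hi)
      have hj' := Finset.mem_range.1 (ht hj)
      have h := hc.cross_mul_nonneg hz (i := i) (j := j) (by omega) (by omega)
      have e1 : cross ((e.multichoose i : ℂ) * q i) (z * ((e.multichoose j : ℂ) * p j)) =
          e.multichoose i * e.multichoose j * cross (q i) (z * p j) := by
        simp only [cross, Complex.mul_re, Complex.mul_im, Complex.natCast_re, Complex.natCast_im]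
        ring
      rw [e1]
      positivity
    intro h0
    rw [sub_eq_zero, Finset.mul_sum] at h0
    -- The index 0 is split off on both sides: its coefficient is 1, and cross(q_0, z p_0) = Im z
    -- |q_0|² is the strictly positive term.
    have hr : Finset.range (m + 1 + 1) = insert 0 (Finset.Ico 1 (m + 1 + 1)) := by
      ext i; simp; omega
    have hI : Finset.Ico 1 (m + 1 + 1) ⊆ Finset.range (m + 1 + 1) := by
      rw [hr]; exact Finset.subset_insert _ _
    have hcross := cross_self (∑ i ∈ Finset.range (m + 1 + 1), (e.multichoose i : ℂ) * q i)
    nth_rewrite 2 [h0] at hcross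
    have k1 := hnn (Finset.Ico 1 (m + 1 + 1)) (Finset.range (m + 1 + 1)) hI le_rfl
    have k2 := hnn {0} (Finset.Ico 1 (m + 1 + 1)) (by simp) hI
    nth_rewrite 1 [hr] at hcross
    rw [Finset.sum_insert (by simp), cross_add_left] at hcross
    nth_rewrite 1 [hr] at hcross
    rw [Finset.sum_insert (by simp), cross_add_right] at hcross
    simp only [Finset.sum_singleton, Nat.multichoose_zero_right, Nat.cast_one, one_mul] at hcross k2
    rw [hc.zero_eq, cross_self_mul] at hcross
    have hq : 0 < Complex.normSq (q 0) := Complex.normSq_pos.2 fun h => by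
      have := hc.pos
      simp [hc.zero_eq, h, cross] at this
    have := mul_pos hz hq
    linarith

end Point

/-! ### Chow polynomials of dual uniform lattices -/

section Main

variable {k n : ℕ}

/-- K is the rank of the interval from x to the top, and the elements strictly above x are exactly
the subsets of x of size less than K. The two cases are the bottom element and a proper subset. -/
theorem sum_Ioc_top (hkn : k ≤ n) (x : (UniformLattice k n)ᵒᵈ) (K : ℕ)
    (hK : (OrderDual.ofDual x).1 = Finset.univ ∧ K = k ∨
      (OrderDual.ofDual x).1.card < k ∧ K = (OrderDual.ofDual x).1.card) (g : ℕ → ℂ) :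
    ∑ w ∈ Finset.Ioc x ⊤, g (OrderDual.ofDual w).1.card =
      ∑ j ∈ Finset.range K, ((OrderDual.ofDual x).1.card.choose j : ℂ) * g j := by
  set A := (OrderDual.ofDual x).1 with hA
  have hKA : K ≤ A.card := by
    rcases hK with ⟨h, rfl⟩ | ⟨h, rfl⟩
    · rw [h]; simpa using hkn
    · exact le_rfl
  have hKk : K ≤ k := by
    rcases hK with ⟨h, rfl⟩ | ⟨h, rfl⟩
    · exact le_rfl
    · exact h.le
  have h1 : ∑ w ∈ Finset.Ioc x ⊤, g (OrderDual.ofDual w).1.card =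
      ∑ B ∈ A.powerset.filter (fun B => B.card < K), g B.card := by
    refine Finset.sum_bij (fun w _ => (OrderDual.ofDual w).1) ?_ ?_ ?_ ?_
    · intro w hw
      have hlt : (OrderDual.ofDual w).1 ⊂ A := (Finset.mem_Ioc.1 hw).1
      refine Finset.mem_filter.2 ⟨Finset.mem_powerset.2 hlt.1, ?_⟩
      rcases hK with ⟨h, rfl⟩ | ⟨h, rfl⟩
      · refine ((mem_uniformFinset hkn).1 (OrderDual.ofDual w).2).resolve_right fun hw => ?_
        rw [hw, h] at hlt
        exact hlt.2 le_rfl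
      · exact Finset.card_lt_card hlt
    · intro w _ w' _ h
      exact OrderDual.ofDual.injective (Subtype.ext h)
    · intro B hB
      obtain ⟨hB, hc⟩ := Finset.mem_filter.1 hB
      refine ⟨OrderDual.toDual ⟨B, (mem_uniformFinset hkn).2 (Or.inl (hc.trans_le hKk))⟩, ?_, rfl⟩
      refine Finset.mem_Ioc.2 ⟨?_, le_top⟩
      have hss : B ⊂ A := (Finset.mem_powerset.1 hB).ssubset_of_ne fun h => by
        rw [h] at hc; omega
      exact hss
    · intro w _
      rfl
  rw [h1, Finset.sum_filter, Finset.sum_powerset_apply_card (fun c => if c < K then g c else 0)]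
  simp only [nsmul_eq_mul, mul_ite, mul_zero]
  rw [← Finset.sum_filter]
  refine Finset.sum_congr ?_ fun _ _ => rfl
  ext j
  simp only [Finset.mem_filter, Finset.mem_range]
  omega

theorem one_sub_mul_aeval_chow (hkn : k ≤ n) (z : ℂ) (x : (UniformLattice k n)ᵒᵈ) (K : ℕ)
    (hK : (OrderDual.ofDual x).1 = Finset.univ ∧ K = k ∨
      (OrderDual.ofDual x).1.card < k ∧ K = (OrderDual.ofDual x).1.card)
    (h : ∀ w ∈ Finset.Ioc x ⊤,
      aeval z (chow w ⊤) = (eulerian (OrderDual.ofDual w).1.card).eval z) :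
    (1 - z) * aeval z (chow x ⊤) = chowValue z K (OrderDual.ofDual x).1.card := by
  have h1 := congrArg (aeval z) (one_sub_X_mul_chow (le_top : x ≤ ⊤))
  simp only [map_mul, map_add, map_sub, map_one, aeval_X, map_sum, map_pow] at h1
  rw [h1, chowValue, ← sum_Ioc_top hkn x K hK]
  congr 1
  refine Finset.sum_congr rfl fun w hw => ?_
  have hlt : (OrderDual.ofDual w).1 ⊂ (OrderDual.ofDual x).1 := (Finset.mem_Ioc.1 hw).1
  have hwu : (OrderDual.ofDual w).1 ≠ Finset.univ := fun h =>
    hlt.2 (h ▸ Finset.subset_univ _)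
  have hwc := ((mem_uniformFinset hkn).1 (OrderDual.ofDual w).2).resolve_right hwu
  have hc := Finset.card_lt_card hlt
  have hr : rank w - rank x = K - (OrderDual.ofDual w).1.card := by
    rw [rank_dual_uniformLattice hkn, rank_dual_uniformLattice hkn, corank, corank, if_neg hwu]
    rcases hK with ⟨h, rfl⟩ | ⟨h, rfl⟩
    · rw [if_pos h]; omega
    · rw [if_neg fun hu => ?_]
      · omega
      · rw [hu, Finset.card_univ, Fintype.card_fin] at h
        omega
  rw [hr, h w hw]

/-- The interval above x is Boolean, and its recurrence is the convolution identity of the Eulerian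
polynomials (`chowValue_self`). -/
theorem aeval_chow_of_card_lt (hkn : k ≤ n) {z : ℂ} (hz : 1 - z ≠ 0) (x : (UniformLattice k n)ᵒᵈ)
    (hx : (OrderDual.ofDual x).1.card < k) :
    aeval z (chow x ⊤) = (eulerian (OrderDual.ofDual x).1.card).eval z := by
  induction hc : (OrderDual.ofDual x).1.card using Nat.strong_induction_on generalizing x with
  | _ c ih =>
    subst hc
    refine mul_left_cancel₀ hz ?_
    rw [← chowValue_self]
    refine one_sub_mul_aeval_chow hkn z x _ (Or.inr ⟨hx, rfl⟩) fun w hw => ?_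
    have hlt : (OrderDual.ofDual w).1 ⊂ (OrderDual.ofDual x).1 := (Finset.mem_Ioc.1 hw).1
    have hc := Finset.card_lt_card hlt
    exact ih _ hc w (hc.trans hx) rfl

theorem card_lt_of_mem_Ioc_bot (hkn : k ≤ n) {w : (UniformLattice k n)ᵒᵈ}
    (hw : w ∈ Finset.Ioc ⊥ ⊤) : (OrderDual.ofDual w).1.card < k := by
  have hlt : (OrderDual.ofDual w).1 ⊂ (Finset.univ : Finset (Fin n)) := (Finset.mem_Ioc.1 hw).1
  exact ((mem_uniformFinset hkn).1 (OrderDual.ofDual w).2).resolve_right fun h => hlt.ne h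

theorem one_sub_mul_aeval_chowPoly (hkn : k ≤ n) {z : ℂ} (hz : 1 - z ≠ 0) :
    (1 - z) * aeval z (chowPoly (UniformLattice k n)ᵒᵈ) = chowValue z k n := by
  have h := one_sub_mul_aeval_chow hkn z ⊥ k (Or.inl ⟨rfl, rfl⟩) fun w hw =>
    aeval_chow_of_card_lt hkn hz w (card_lt_of_mem_Ioc_bot hkn hw)
  rwa [show (OrderDual.ofDual (⊥ : (UniformLattice k n)ᵒᵈ)).1.card = n from
    Finset.card_fin n] at h

theorem one_sub_mul_aeval_augChowPoly (hkn : k ≤ n) {z : ℂ} (hz : 1 - z ≠ 0) :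
    (1 - z) * aeval z (augChowPoly (UniformLattice k n)ᵒᵈ) = chowValue z (k + 1) n := by
  have h1 := one_sub_mul_aeval_chowPoly hkn hz
  have h2 := congrArg (aeval z) (augChow_eq (bot_le : (⊥ : (UniformLattice k n)ᵒᵈ) ≤ ⊤))
  rw [← Finset.Ioc_insert_left bot_le, Finset.sum_insert (by simp)] at h2
  simp only [map_mul, map_add, map_sub, map_one, aeval_X, map_sum] at h2
  have h3 : ∑ w ∈ Finset.Ioc (⊥ : (UniformLattice k n)ᵒᵈ) ⊤, aeval z (chow w ⊤) =
      ∑ j ∈ Finset.range k, (n.choose j : ℂ) * (eulerian j).eval z := by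
    rw [Finset.sum_congr rfl fun w hw =>
      aeval_chow_of_card_lt hkn hz w (card_lt_of_mem_Ioc_bot hkn hw),
      sum_Ioc_top hkn ⊥ k (Or.inl ⟨rfl, rfl⟩) fun j => (eulerian j).eval z,
      show (OrderDual.ofDual (⊥ : (UniformLattice k n)ᵒᵈ)).1.card = n from Finset.card_fin n]
  rw [chowPoly] at h1
  rw [augChowPoly, h2, h3]
  -- Termwise z - z^{k+1-j} = z (z - z^{k-j}) + z (1 - z). The extra term j = k of `chowValue z (k +
  -- 1) n` vanishes.
  have h4 : ∑ j ∈ Finset.range k,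
      (n.choose j : ℂ) * ((z - z ^ (k + 1 - j)) * (eulerian j).eval z) =
      z * ∑ j ∈ Finset.range k, (n.choose j : ℂ) * ((z - z ^ (k - j)) * (eulerian j).eval z) +
        z * (1 - z) * ∑ j ∈ Finset.range k, (n.choose j : ℂ) * (eulerian j).eval z := by
    rw [Finset.mul_sum, Finset.mul_sum, ← Finset.sum_add_distrib]
    refine Finset.sum_congr rfl fun j hj => ?_
    rw [show k + 1 - j = k - j + 1 by have := Finset.mem_range.1 hj; omega, pow_succ]
    ring
  rw [chowValue] at h1 ⊢
  rw [Finset.sum_range_succ, h4, Nat.add_sub_cancel_left, pow_one, sub_self, zero_mul, mul_zero]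
  linear_combination z * h1

theorem onlyRealZeros_of_upperHalfPlane {p : ℤ[X]} (h : ∀ z : ℂ, 0 < z.im → aeval z p ≠ 0) :
    OnlyRealZeros p := by
  intro z hz
  rcases lt_trichotomy z.im 0 with him | him | him
  · refine absurd ?_ (h ((starRingEnd ℂ) z) (by simpa using him))
    have := aeval_algHom_apply ((starRingEnd ℂ).toIntAlgHom) z p
    rw [hz, map_zero] at this
    exact this
  · exact him
  · exact absurd hz (h z him)

end Main

end ChowPoset

theorem corollary1p3 (k n : ℕ) (hkn : k ≤ n) :
    ChowPoset.OnlyRealZeros (ChowPoset.chowPoly (ChowPoset.UniformLattice k n)ᵒᵈ) ∧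
      ChowPoset.OnlyRealZeros (ChowPoset.augChowPoly (ChowPoset.UniformLattice k n)ᵒᵈ) := by
  have hne : ∀ z : ℂ, 0 < z.im → 1 - z ≠ 0 := fun z hz h => by
    have := congrArg Complex.im h
    simp only [Complex.sub_im, Complex.one_im, Complex.zero_im] at this
    linarith
  constructor
  · refine ChowPoset.onlyRealZeros_of_upperHalfPlane fun z hz h0 => ?_
    refine ChowPoset.chowValue_ne_zero hz (show k ≤ n + 1 by omega) ?_
    rw [← ChowPoset.one_sub_mul_aeval_chowPoly hkn (hne z hz), h0, mul_zero]
  · refine ChowPoset.onlyRealZeros_of_upperHalfPlane fun z hz h0 => ?_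
    refine ChowPoset.chowValue_ne_zero hz (show k + 1 ≤ n + 1 by omega) ?_
    rw [← ChowPoset.one_sub_mul_aeval_augChowPoly hkn (hne z hz), h0, mul_zero]
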